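/- Let $R$ be an associative ring with identity that is left pure semisimple, i.e. every left $R$-module is a direct sum of finitely generated modules. For a left $R$-module $A$ let $A^+=\operatorname{Hom}_{\mathbb Z}(A,\mathbb Q/\mathbb Z)$, a right $R$-module via $(\varphi r)(a)=\varphi(ra)$, and for a homomorphism $f:A\to B$ of left $R$-modules let $f^+:B^+\to A^+$, $\varphi\mapsto\varphi f$. For a class $\mathcal D$ of modules, a homomorphism $f:X\to Y$ is a $\mathcal D$-precover of $Y$ if $X\in\mathcal D$ and every homomorphism $g:X'\to Y$ with $X'\in\mathcal D$ is of the form $g=fh$ for some $h:X'\to X$; it is a $\mathcal D$-cover if moreover every endomorphism $h$ of $X$ with $fh=f$ is an automorphism. Dually, $f:X\to Y$ is a $\mathcal C$-preenvelope of $X$ if $Y\in\mathcal C$ and every homomorphism $g:X\to Y'$ with $Y'\in\mathcal C$ is of the form $g=hf$ for some $h:Y\to Y'$; it is a $\mathcal C$-envelope if moreover every endomorphism $h$ of $Y$ with $hf=f$ is an automorphism. Let $\mathcal C$ be a class of left $R$-modules and $\mathcal D$ a class of right $R$-modules such that $X^+\in\mathcal D$ for every $X\in\mathcal C$. Let $f:A\to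 C$ be a homomorphism of left $R$-modules with $C\in\mathcal C$. If $f^+:C^+\to A^+$ is a $\mathcal D$-precover of $A^+$, then $f$ is a $\mathcal C$-preenvelope of $A$; and if $f^+$ is a $\mathcal D$-cover of $A^+$, then $f$ is a $\mathcal C$-envelope of $A$. -/

import Mathlib

open CategoryTheory DirectSum

universe u v

namespace ModApprox

section Approximations

variable {V : Type u} [Category.{v} V]

/-- `f : X ⟶ Y` is a `D`-precover of `Y`: `X` is in the class `D`, and every morphism to `Y` from
an object of `D` factors through `f`. -/
structure IsPrecover (D : ObjectProperty V) {X Y : V} (f : X ⟶ Y) : Prop where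
  mem : D X
  factors : ∀ (X' : V), D X' → ∀ g : X' ⟶ Y, ∃ h : X' ⟶ X, h ≫ f = g

/-- `f : X ⟶ Y` is right minimal: every endomorphism `h` of `X` with `f ∘ h = f` is an
automorphism. -/
def IsRightMinimal {X Y : V} (f : X ⟶ Y) : Prop :=
  ∀ h : X ⟶ X, h ≫ f = f → IsIso h

/-- A `D`-cover is a right minimal `D`-precover. -/
structure IsCover (D : ObjectProperty V) {X Y : V} (f : X ⟶ Y) : Prop where
  isPrecover : IsPrecover D f
  isRightMinimal : IsRightMinimal f

/-- `f : X ⟶ Y` is a `C`-preenvelope of `X`: `Y` is in the class `C`, and every morphism from `X`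
to an object of `C` factors through `f`. -/
structure IsPreenvelope (C : ObjectProperty V) {X Y : V} (f : X ⟶ Y) : Prop where
  mem : C Y
  factors : ∀ (Y' : V), C Y' → ∀ g : X ⟶ Y', ∃ h : Y ⟶ Y', f ≫ h = g

/-- `f : X ⟶ Y` is left minimal: every endomorphism `h` of `Y` with `h ∘ f = f` is an
automorphism. -/
def IsLeftMinimal {X Y : V} (f : X ⟶ Y) : Prop :=
  ∀ h : Y ⟶ Y, f ≫ h = f → IsIso h

/-- A `C`-envelope is a left minimal `C`-preenvelope. -/
structure IsEnvelope (C : ObjectProperty V) {X Y : V} (f : X ⟶ Y) : Prop where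
  isPreenvelope : IsPreenvelope C f
  isLeftMinimal : IsLeftMinimal f

end Approximations

section Dual

variable {R : Type u} [Ring R]

/-- For a left `R`-module `A`, the group `A⁺ = Hom_ℤ(A, ℚ/ℤ)` is a right `R`-module (a left module
over the opposite ring) via `(φ r)(a) = φ (r a)`. -/
instance characterModuleRight (A : Type v) [AddCommGroup A] [Module R A] :
    Module Rᵐᵒᵖ (CharacterModule A) where
  smul r φ := AddMonoidHom.comp (φ : A →+ AddCircle (1 : ℚ)) (DistribSMul.toAddMonoidHom A r.unop)
  one_smul φ := CharacterModule.ext _ fun a => congrArg φ (one_smul R a)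
  mul_smul r s φ := CharacterModule.ext _ fun a => congrArg φ (mul_smul s.unop r.unop a)
  smul_zero _ := rfl
  smul_add _ _ _ := rfl
  add_smul r s φ := CharacterModule.ext _ fun a =>
    (congrArg φ (add_smul r.unop s.unop a)).trans (map_add φ _ _)
  zero_smul φ := CharacterModule.ext _ fun a => (congrArg φ (zero_smul R a)).trans (map_zero φ)

theorem op_smul_apply {A : Type v} [AddCommGroup A] [Module R A] (r : Rᵐᵒᵖ)
    (φ : CharacterModule A) (a : A) : (r • φ) a = φ (r.unop • a) := rfl

/-- The right `R`-module `A⁺` of a left `R`-module `A`. -/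
abbrev plus (A : ModuleCat.{v} R) : ModuleCat.{v} Rᵐᵒᵖ :=
  ModuleCat.of Rᵐᵒᵖ (CharacterModule A)

/-- The homomorphism `f⁺ : B⁺ ⟶ A⁺`, `φ ↦ φ ∘ f`, of a homomorphism `f : A ⟶ B`. -/
def plusMap {A B : ModuleCat.{v} R} (f : A ⟶ B) : plus B ⟶ plus A :=
  ModuleCat.ofHom
    { toFun := fun φ => AddMonoidHom.comp (φ : B →+ AddCircle (1 : ℚ)) f.hom.toAddMonoidHom
      map_add' := fun _ _ => rfl
      map_smul' := fun r φ => CharacterModule.ext _ fun a =>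
        congrArg φ (map_smul f.hom r.unop a).symm }

theorem plusMap_apply {A B : ModuleCat.{v} R} (f : A ⟶ B) (φ : CharacterModule B) (a : A) :
    (show CharacterModule A from (plusMap f).hom φ) a = φ (f.hom a) := rfl

end Dual

/-- `R` is left pure semisimple: every left `R`-module is a direct sum of finitely generated
modules. -/
def IsLeftPureSemisimple (R : Type u) [Ring R] : Prop :=
  ∀ (M : Type u) [AddCommGroup M] [Module R M],
    ∃ (ι : Type u) (N : ι → Type u) (_ : ∀ i, AddCommGroup (N i)) (_ : ∀ i, Module R (N i)),
      (∀ i, Module.Finite R (N i)) ∧ Nonempty (M ≃ₗ[R] ⨁ i, N i)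

end ModApprox

/-! A factorization of `g⁺ : X⁺ → A⁺` through `f⁺` is a map `X⁺ → C⁺`, whose adjoint `C → X⁺⁺`
(`bidualLift`) extends `A → X → X⁺⁺` along `f`. A retraction of `X → X⁺⁺` turns it into a map `C →
X` extending `g`, so the crux is `exists_retraction_toBidual`. The embedding `X → X⁺⁺` is always
pure (`exists_solution_of_bidual`). Its cokernel is a direct sum of finitely generated modules;
these are finitely presented once `R` is left noetherian, so purity lifts each summand and the
sequence splits. Noetherianity follows from a Chase-type argument
(`IsLeftPureSemisimple.isNoetherianRing`). Minimality passes from `f⁺` to `f` because `(-)⁺`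
reflects isomorphisms. -/

namespace ModApprox

/-! ### Left pure semisimple rings are left noetherian. -/

section Noetherian

variable {R : Type u} [Ring R]

/-- Chase's lemma for the annihilators of an increasing chain of left ideals. -/
theorem exists_finset_of_pi_linearMap_directSum (I : ℕ → Ideal R) (hI : Monotone I)
    {M : ℕ → Type*} [∀ i, AddCommGroup (M i)] [∀ i, Module R (M i)]
    {ι : Type*} {N : ι → Type*} [∀ j, AddCommGroup (N j)] [∀ j, Module R (N j)]
    (e : (∀ i, M i) →ₗ[R] ⨁ j, N j) :
    ∃ (n : ℕ) (F : Finset ι), ∀ x : ∀ i, M i, (∀ i < n, x i = 0) → (∀ r ∈ I n, r • x = 0) →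
      ∀ j ∉ F, ∀ k, ∀ r ∈ I k, r • e x j = 0 := by
  classical
  by_contra! H
  choose X hX0 hXI J hJ K r hr hne using H
  -- The next level exceeds `K`, so that the multiplier `r` of this stage kills all later `x t`; the
  -- finset absorbs the support of `e (x t)`, so that later indices `J` avoid it.
  let s : ℕ → ℕ × Finset ι := fun t => Nat.rec (0, ∅)
    (fun _ p => (max (K p.1 p.2) (p.1 + 1), p.2 ∪ DFinsupp.support (e (X p.1 p.2)))) t
  let x : ℕ → ∀ i, M i := fun t => X (s t).1 (s t).2
  let j : ℕ → ι := fun t => J (s t).1 (s t).2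
  have hs1 : ∀ t, (s (t + 1)).1 = max (K (s t).1 (s t).2) ((s t).1 + 1) := fun _ => rfl
  have hs2 : ∀ t, (s (t + 1)).2 = (s t).2 ∪ DFinsupp.support (e (x t)) := fun _ => rfl
  have hmono : StrictMono fun t => (s t).1 := strictMono_nat_of_lt_succ fun t => by
    simp only [hs1]; omega
  have hmono2 : Monotone fun t => (s t).2 := monotone_nat_of_le_succ fun t => by
    simp only [hs2]; exact Finset.subset_union_left
  have hsupp : ∀ t T, t < T → DFinsupp.support (e (x t)) ⊆ (s T).2 := fun t T h =>
    (Finset.subset_union_right.trans (hs2 t).ge).trans (hmono2 (Nat.succ_le_of_lt h))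
  have hx0 : ∀ t i, i < t → x t i = 0 := fun t i h => hX0 _ _ i (h.trans_le (hmono.id_le t))
  -- The infinite sum of the `x t`, finite in each coordinate; `e y` will be nonzero at every `j T`,
  -- contradicting finite support.
  let y : ∀ i, M i := fun i => ∑ t ∈ Finset.range (i + 1), x t i
  have hy : ∀ i S, i + 1 ≤ S → y i = ∑ t ∈ Finset.range S, x t i := fun i S h =>
    Finset.sum_subset (Finset.range_mono h) fun t _ ht => hx0 t i (by
      simp only [Finset.mem_range] at ht; omega)
  have htail : ∀ T, ∀ a ∈ I (s T).1, a • (y - ∑ t ∈ Finset.range T, x t) = 0 := by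
    intro T a ha
    funext i
    have h1 := hy i (max T (i + 1)) (le_max_right _ _)
    have h2 := Finset.sum_range_add_sum_Ico (fun t => x t i) (le_max_left T (i + 1))
    simp only [Pi.smul_apply, Pi.sub_apply, Finset.sum_apply, Pi.zero_apply]
    rw [h1, ← h2, add_sub_cancel_left, Finset.smul_sum]
    refine Finset.sum_eq_zero fun t ht => ?_
    exact congrFun (hXI (s t).1 (s t).2 a
      (hI (hmono.monotone (Finset.mem_Ico.1 ht).1) ha)) i
  have hyj : ∀ T, e y (j T) ≠ 0 := by
    intro T h0
    refine hne (s T).1 (s T).2 ?_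
    have ha : r (s T).1 (s T).2 ∈ I (s (T + 1)).1 :=
      hI ((le_max_left _ _).trans (hs1 T).ge) (hr (s T).1 (s T).2)
    have h1 := DFunLike.congr_fun (congrArg e (htail (T + 1) _ ha)) (j T)
    rw [map_smul, map_sub, map_sum, map_zero, Finset.sum_range_succ] at h1
    have h3 : (∑ t ∈ Finset.range T, e (x t)) (j T) = 0 := by
      rw [DFinsupp.finsetSum_apply]
      refine Finset.sum_eq_zero fun t ht => ?_
      by_contra hc
      exact hJ _ _ (hsupp t T (Finset.mem_range.1 ht) (DFinsupp.mem_support_iff.2 hc))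
    rw [DirectSum.smul_apply, DirectSum.sub_apply, DirectSum.add_apply, h0, h3, zero_add,
      zero_sub, smul_neg, DirectSum.zero_apply, neg_eq_zero] at h1
    exact h1
  have hjmem : ∀ T, j T ∈ DFinsupp.support (e (x T)) := fun T =>
    DFinsupp.mem_support_iff.2 fun h => hne (s T).1 (s T).2 (by
      change _ • e (x T) (j T) = 0
      rw [h, smul_zero])
  have hjne : ∀ t T, t < T → j t ≠ j T := fun t T h he =>
    hJ (s T).1 (s T).2 (show j T ∈ _ from he ▸ hsupp t T h (hjmem t))
  have hinj : Function.Injective j := fun t T h => by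
    rcases lt_trichotomy t T with h' | h' | h'
    · exact (hjne _ _ h' h).elim
    · exact h'
    · exact (hjne _ _ h' h.symm).elim
  exact Set.infinite_range_of_injective hinj ((DFinsupp.support (e y)).finite_toSet.subset (by
    rintro _ ⟨T, rfl⟩
    exact DFinsupp.mem_support_iff.2 (hyj T)))

/-- A finitely generated module is too small to receive an injection from the power set of the
type of finite words in the ring. -/
theorem not_injective_set_list_of_finite {N : Type*} [AddCommGroup N] [Module R N]
    [Module.Finite R N] (g : Set (List R) → N) : ¬ Function.Injective g := by
  intro hg
  obtain ⟨n, π, hπ⟩ := Module.Finite.exists_fin' R N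
  refine Function.cantor_injective (fun S => List.ofFn (Function.surjInv hπ (g S))) ?_
  exact List.ofFn_injective.comp ((Function.injective_surjInv hπ).comp hg)

theorem IsLeftPureSemisimple.isNoetherianRing (hR : IsLeftPureSemisimple R) :
    IsNoetherianRing R := by
  classical
  refine isNoetherian_iff'.2 (wellFoundedGT_iff_monotone_chain_condition.2 fun I => ?_)
  by_contra! H
  -- Taking `List R` copies of each quotient makes the product too large to be controlled by
  -- finitely many finitely generated summands.
  obtain ⟨ι, N, _, _, hN, ⟨e⟩⟩ := hR (∀ i : ℕ, List R → R ⧸ I i)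
  obtain ⟨n, F, hF⟩ := exists_finset_of_pi_linearMap_directSum I I.monotone
    (e : (∀ i : ℕ, List R → R ⧸ I i) →ₗ[R] ⨁ j, N j)
  obtain ⟨m, hnm, hm⟩ := H n
  obtain ⟨a, ham, han⟩ := SetLike.exists_of_lt (lt_of_le_of_ne (I.monotone hnm) hm)
  let q : Set (List R) → ∀ i : ℕ, List R → R ⧸ I i := fun S =>
    Pi.single n fun l => if l ∈ S then Submodule.Quotient.mk 1 else 0
  have hone : ∀ r : R, r • (Submodule.Quotient.mk 1 : R ⧸ I n) = 0 ↔ r ∈ I n := fun r => by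
    rw [← Submodule.Quotient.mk_smul, Submodule.Quotient.mk_eq_zero, smul_eq_mul, mul_one]
  have hq0 : ∀ S, ∀ i < n, q S i = 0 := fun S i hi => Pi.single_eq_of_ne hi.ne _
  have hqI : ∀ S, ∀ r ∈ I n, r • q S = 0 := by
    intro S r hr
    funext i l
    by_cases hi : i = n
    · subst hi
      by_cases hl : l ∈ S <;> simp [q, hl, (hone r).2 hr]
    · simp [q, Pi.single_eq_of_ne hi]
  refine not_injective_set_list_of_finite (R := R)
    (fun S => fun j : F => e (q S) j) fun S T hST => ?_
  -- Components in `F` agree by `hST`; those outside are killed by `a ∈ I m`. Since `a ∉ I n`, this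
  -- forces `S = T`.
  have hzero : a • (q S - q T) = 0 := by
    refine e.injective ?_
    rw [map_smul, map_zero]
    refine DFinsupp.ext fun j => ?_
    rw [DirectSum.smul_apply, DirectSum.zero_apply]
    by_cases hj : j ∈ F
    · have := congrFun hST ⟨j, hj⟩
      rw [map_sub, DirectSum.sub_apply, sub_eq_zero.2 this, smul_zero]
    · refine hF (q S - q T) (fun i hi => ?_) (fun r hr => ?_) j hj m a ham
      · rw [Pi.sub_apply, hq0 S i hi, hq0 T i hi, sub_zero]
      · rw [smul_sub, hqI S r hr, hqI T r hr, sub_zero]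
  ext l
  have hl := congrFun (congrFun hzero n) l
  simp only [q, Pi.smul_apply, Pi.sub_apply, Pi.single_eq_same, Pi.zero_apply] at hl
  by_cases hS : l ∈ S <;> by_cases hT : l ∈ T <;> simp [hS, hT, hone, han] at hl ⊢

end Noetherian

/-! ### Purity and splitting of the embedding into the double character module. -/

section Bidual

variable {R : Type u} [Ring R]

/-- The double character module `X⁺⁺`, regarded as a left `R`-module. -/
def Bidual (X : Type v) [AddCommGroup X] : Type v :=
  CharacterModule (CharacterModule X)

instance (X : Type v) [AddCommGroup X] : AddCommGroup (Bidual X) :=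
  inferInstanceAs (AddCommGroup (CharacterModule (CharacterModule X)))

instance (X : Type v) [AddCommGroup X] [Module R X] : Module R (Bidual X) :=
  letI := characterModuleRight (R := Rᵐᵒᵖ) (CharacterModule X)
  Module.compHom (CharacterModule (CharacterModule X)) (RingEquiv.opOp R).toRingHom

/-- The value of an element of `X⁺⁺` at a character. -/
def Bidual.eval {X : Type v} [AddCommGroup X] (φ : CharacterModule X) :
    Bidual X →+ AddCircle (1 : ℚ) where
  toFun y := (show CharacterModule (CharacterModule X) from y) φ
  map_zero' := rfl
  map_add' _ _ := rfl

variable {X : Type v} [AddCommGroup X] [Module R X]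

theorem Bidual.eval_smul (r : R) (y : Bidual X) (φ : CharacterModule X) :
    Bidual.eval φ (r • y) = Bidual.eval (MulOpposite.op r • φ) y := rfl

theorem Bidual.eval_sum {ι : Type*} (s : Finset ι) (φ : ι → CharacterModule X) (y : Bidual X) :
    Bidual.eval (∑ i ∈ s, φ i) y = ∑ i ∈ s, Bidual.eval (φ i) y :=
  map_sum (show CharacterModule (CharacterModule X) from y) φ s

variable (R X) in
/-- The canonical map `X → X⁺⁺`. -/
def toBidual : X →ₗ[R] Bidual X where
  toFun x := show CharacterModule (CharacterModule X) from
    { toFun := fun φ => φ x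
      map_zero' := rfl
      map_add' := fun _ _ => rfl }
  map_add' x y := CharacterModule.ext _ fun φ => map_add φ x y
  map_smul' _ _ := rfl

theorem Bidual.eval_toBidual (x : X) (φ : CharacterModule X) :
    Bidual.eval φ (toBidual R X x) = φ x := rfl

theorem toBidual_injective : Function.Injective (toBidual R X) :=
  (injective_iff_map_eq_zero _).2 fun x hx => CharacterModule.eq_zero_of_character_apply fun c => by
    rw [← Bidual.eval_toBidual (R := R), hx, map_zero]

theorem exists_character_of_notMem_range {G H : Type*} [AddCommGroup G] [AddCommGroup H]
    (L : G →ₗ[ℤ] H) {b : H} (hb : b ∉ LinearMap.range L) :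
    ∃ φ : H →+ AddCircle (1 : ℚ), (∀ x, φ (L x) = 0) ∧ φ b ≠ 0 := by
  obtain ⟨c, hc⟩ := CharacterModule.exists_character_apply_ne_zero_of_ne_zero
    (mt (Submodule.Quotient.mk_eq_zero _).1 hb)
  refine ⟨AddMonoidHom.comp (show _ →+ AddCircle (1 : ℚ) from c)
    (LinearMap.range L).mkQ.toAddMonoidHom, fun x => ?_, hc⟩
  change c ((LinearMap.range L).mkQ (L x)) = 0
  rw [Submodule.mkQ_apply, (Submodule.Quotient.mk_eq_zero _).2 (LinearMap.mem_range_self L x), map_zero]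

/-- `X → X⁺⁺` is a pure monomorphism: a finite system of linear equations with constants in `X`
that is solvable in `X⁺⁺` is solvable in `X`. -/
theorem exists_solution_of_bidual {m n : Type*} [Fintype m] [Fintype n] (a : m → n → R)
    (b : m → X) (y : n → Bidual X) (h : ∀ i, ∑ j, a i j • y j = toBidual R X (b i)) :
    ∃ x : n → X, ∀ i, ∑ j, a i j • x j = b i := by
  classical
  let L : (n → X) →ₗ[ℤ] (m → X) := AddMonoidHom.toIntLinearMap
    { toFun := fun x i => ∑ j, a i j • x j
      map_zero' := by
        funext i; simp
      map_add' := fun x y => by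
        funext i; simp [smul_add, Finset.sum_add_distrib] }
  by_contra hx
  -- A character vanishing on the image of the system but not at `b` gives coefficients `ψ i`
  -- annihilating the columns of `a`; applied to the solution `y`, they force `φ b = 0`.
  obtain ⟨φ, hφ, hne⟩ := exists_character_of_notMem_range L (b := b) fun ⟨x, hx'⟩ =>
    hx ⟨x, congrFun hx'⟩
  let ψ : m → CharacterModule X := fun i => φ.comp (AddMonoidHom.single (fun _ : m => X) i)
  have hψ : ∀ z : m → X, φ z = ∑ i, ψ i (z i) := fun z => by
    conv_lhs => rw [← Finset.univ_sum_single z]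
    exact map_sum φ _ _
  have hzero : ∀ j, ∑ i, MulOpposite.op (a i j) • ψ i = 0 := fun j => by
    refine CharacterModule.ext _ fun x => ?_
    have h1 : (∑ i, MulOpposite.op (a i j) • ψ i) x = ∑ i, ψ i (a i j • x) := by
      rw [← Bidual.eval_toBidual (R := R), Bidual.eval_sum]
      rfl
    have h2 := hφ (Pi.single j x)
    rw [hψ] at h2
    rw [h1]
    refine Eq.trans (Finset.sum_congr rfl fun i _ => ?_) h2
    change _ = ψ i (∑ k, a i k • (Pi.single j x : n → X) k)
    rw [Finset.sum_eq_single j (fun k _ hk => by rw [Pi.single_eq_of_ne hk, smul_zero])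
      (fun hj => (hj (Finset.mem_univ j)).elim), Pi.single_eq_same]
  refine hne ?_
  calc φ b = ∑ i, ψ i (b i) := hψ b
    _ = ∑ i, ∑ j, Bidual.eval (MulOpposite.op (a i j) • ψ i) (y j) :=
        Finset.sum_congr rfl fun i _ => by
          rw [← Bidual.eval_toBidual (R := R), ← h i, map_sum]
          rfl
    _ = ∑ j, Bidual.eval (∑ i, MulOpposite.op (a i j) • ψ i) (y j) := by
        rw [Finset.sum_comm]
        exact Finset.sum_congr rfl fun j _ => (Bidual.eval_sum _ _ _).symm
    _ = 0 := Finset.sum_eq_zero fun j _ => by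
        rw [hzero j]
        exact map_zero (show CharacterModule (CharacterModule X) from y j)

/-- Lift `g` to a free cover of `F`. The finitely many relations are sent into the image of `X`, and
purity gives a correction with values in `X` after which they are sent to zero. -/
theorem exists_lift_of_finite [IsNoetherianRing R] {F : Type*} [AddCommGroup F] [Module R F]
    [Module.Finite R F] (g : F →ₗ[R] Bidual X ⧸ LinearMap.range (toBidual R X)) :
    ∃ l : F →ₗ[R] Bidual X, (LinearMap.range (toBidual R X)).mkQ ∘ₗ l = g := by
  classical
  obtain ⟨n, π, hπ⟩ := Module.Finite.exists_fin' R F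
  obtain ⟨l, hl⟩ := Module.projective_lifting_property (LinearMap.range (toBidual R X)).mkQ
    (g ∘ₗ π) (Submodule.mkQ_surjective _)
  obtain ⟨m, k, hk⟩ := Submodule.fg_iff_exists_fin_generating_family.1
    (IsNoetherian.noetherian (LinearMap.ker π))
  have hkπ : ∀ i, π (k i) = 0 := fun i =>
    LinearMap.mem_ker.1 (hk ▸ Submodule.subset_span ⟨i, rfl⟩)
  have hmem : ∀ i, l (k i) ∈ LinearMap.range (toBidual R X) := fun i => by
    rw [← Submodule.Quotient.mk_eq_zero, ← Submodule.mkQ_apply, ← LinearMap.comp_apply, hl,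
      LinearMap.comp_apply, hkπ, map_zero]
  choose b hb using hmem
  obtain ⟨x, hx⟩ := exists_solution_of_bidual k b (fun j => l (Pi.single j 1)) fun i => by
    rw [hb, LinearMap.pi_apply_eq_sum_univ l (k i)]
    refine Finset.sum_congr rfl fun j _ => congrArg (fun w => k i j • l w) (funext fun j' => ?_)
    simp [Pi.single_apply, eq_comm]
  let l' := l - toBidual R X ∘ₗ Fintype.linearCombination R x
  have hker : LinearMap.ker π ≤ LinearMap.ker l' := by
    rw [← hk, Submodule.span_le]
    rintro _ ⟨i, rfl⟩
    change l' (k i) = 0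
    rw [LinearMap.sub_apply, LinearMap.comp_apply, Fintype.linearCombination_apply, hx, hb,
      sub_self]
  refine ⟨(LinearMap.ker π).liftQ l' hker ∘ₗ (π.quotKerEquivOfSurjective hπ).symm, ?_⟩
  refine LinearMap.ext fun z => ?_
  obtain ⟨w, rfl⟩ := hπ z
  have hw : (π.quotKerEquivOfSurjective hπ).symm (π w) = Submodule.Quotient.mk w :=
    (LinearEquiv.symm_apply_eq _).2 rfl
  simp only [LinearMap.comp_apply, LinearEquiv.coe_coe, hw, Submodule.liftQ_apply]
  have h0 : (LinearMap.range (toBidual R X)).mkQ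
      (toBidual R X (Fintype.linearCombination R x w)) = 0 :=
    (Submodule.Quotient.mk_eq_zero _).2 ⟨_, rfl⟩
  have h1 := LinearMap.congr_fun hl w
  simp only [LinearMap.comp_apply] at h1
  rw [LinearMap.sub_apply, map_sub, LinearMap.comp_apply, h0, sub_zero, h1]

end Bidual

/-- Over a left pure semisimple ring every left module is a direct summand of its double
character module. -/
theorem IsLeftPureSemisimple.exists_retraction_toBidual {R : Type u} [Ring R]
    (hR : IsLeftPureSemisimple R) (X : Type u) [AddCommGroup X] [Module R X] :
    ∃ p : Bidual X →ₗ[R] X, p ∘ₗ toBidual R X = LinearMap.id := by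
  classical
  have := hR.isNoetherianRing
  set U := LinearMap.range (toBidual R X)
  obtain ⟨ι, N, _, _, hN, ⟨e⟩⟩ := hR (Bidual X ⧸ U)
  choose l hl using fun i => exists_lift_of_finite (X := X)
    (e.symm.toLinearMap ∘ₗ DirectSum.lof R ι N i)
  let σ : (Bidual X ⧸ U) →ₗ[R] Bidual X := DirectSum.toModule R ι _ l ∘ₗ e.toLinearMap
  have hσ : ∀ z, U.mkQ (σ z) = z := fun z => by
    have h : U.mkQ ∘ₗ DirectSum.toModule R ι _ l = e.symm.toLinearMap :=
      DirectSum.linearMap_ext R fun i => LinearMap.ext fun w => by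
        simpa using LinearMap.congr_fun (hl i) w
    exact (LinearMap.congr_fun h (e z)).trans (e.symm_apply_apply z)
  let ε : X ≃ₗ[R] U := LinearEquiv.ofInjective _ toBidual_injective
  let ρ : Bidual X →ₗ[R] U := (LinearMap.id - σ ∘ₗ U.mkQ).codRestrict U fun y => by
    rw [← Submodule.Quotient.mk_eq_zero, ← Submodule.mkQ_apply, LinearMap.sub_apply, map_sub,
      LinearMap.comp_apply, hσ, LinearMap.id_apply, sub_self]
  refine ⟨ε.symm.toLinearMap ∘ₗ ρ, LinearMap.ext fun x => ?_⟩
  change ε.symm (ρ (toBidual R X x)) = x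
  rw [LinearEquiv.symm_apply_eq]
  refine Subtype.ext ?_
  have h0 : U.mkQ (toBidual R X x) = 0 := (Submodule.Quotient.mk_eq_zero _).2 ⟨x, rfl⟩
  change toBidual R X x - σ (U.mkQ (toBidual R X x)) = toBidual R X x
  rw [h0, map_zero, sub_zero]

/-! ### Transfer from `f⁺` to `f`. -/

section Main

variable {R : Type u} [Ring R]

/-- The map `C → X⁺⁺` adjoint to a homomorphism `X⁺ → C⁺`. -/
def bidualLift {C X : ModuleCat.{v} R} (h : plus X ⟶ plus C) : C →ₗ[R] Bidual X where
  toFun c := show CharacterModule (CharacterModule X) from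
    { toFun := fun φ => (show CharacterModule C from h.hom φ) c
      map_zero' := by rw [map_zero]; rfl
      map_add' := fun φ ψ => by rw [map_add]; rfl }
  map_add' c d := CharacterModule.ext _ fun φ =>
    map_add (show CharacterModule C from h.hom φ) c d
  map_smul' r c := CharacterModule.ext _ fun φ =>
    congrArg (fun ψ : CharacterModule C => ψ c) (map_smul h.hom (MulOpposite.op r) φ).symm

theorem bidualLift_comp {A C X : ModuleCat.{v} R} (f : A ⟶ C) (g : A ⟶ X)
    (h : plus X ⟶ plus C) (hh : h ≫ plusMap f = plusMap g) (a : A) :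
    bidualLift h (f.hom a) = toBidual R X (g.hom a) :=
  CharacterModule.ext _ fun φ => congrArg (fun k => (show CharacterModule A from k.hom φ) a) hh

theorem plusMap_comp {A B C : ModuleCat.{v} R} (f : A ⟶ B) (g : B ⟶ C) :
    plusMap (f ≫ g) = plusMap g ≫ plusMap f := rfl

/-- Bijectivity is a matter of the underlying abelian groups, where it is detected by characters to
`ℚ/ℤ`. -/
theorem isIso_of_isIso_plusMap {A B : ModuleCat.{v} R} (f : A ⟶ B) [IsIso (plusMap f)] :
    IsIso f := by
  have hb : Function.Bijective (plusMap f) := ConcreteCategory.bijective_of_isIso (plusMap f)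
  have := CharacterModule.dual_bijective_iff_bijective
    (f := f.hom.toAddMonoidHom.toIntLinearMap).1 hb
  exact (ConcreteCategory.isIso_iff_bijective f).2 this

theorem IsPrecover.isPreenvelope (hR : IsLeftPureSemisimple R)
    {𝒞 : ObjectProperty (ModuleCat.{u} R)} {𝒟 : ObjectProperty (ModuleCat.{u} Rᵐᵒᵖ)}
    (h𝒞𝒟 : ∀ X : ModuleCat.{u} R, 𝒞 X → 𝒟 (plus X)) {A C : ModuleCat.{u} R} (hC : 𝒞 C)
    {f : A ⟶ C} (hf : IsPrecover 𝒟 (plusMap f)) : IsPreenvelope 𝒞 f where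
  mem := hC
  factors X hX g := by
    obtain ⟨h, hh⟩ := hf.factors _ (h𝒞𝒟 X hX) (plusMap g)
    obtain ⟨p, hp⟩ := hR.exists_retraction_toBidual X
    refine ⟨ModuleCat.ofHom (p ∘ₗ bidualLift h), ModuleCat.hom_ext (LinearMap.ext fun a => ?_)⟩
    change p (bidualLift h (f.hom a)) = g.hom a
    rw [bidualLift_comp f g h hh]
    exact LinearMap.congr_fun hp (g.hom a)

theorem IsRightMinimal.isLeftMinimal {A C : ModuleCat.{v} R} {f : A ⟶ C}
    (hf : IsRightMinimal (plusMap f)) : IsLeftMinimal f := fun h hh => by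
  have := hf (plusMap h) (by rw [← plusMap_comp, hh])
  exact isIso_of_isIso_plusMap h

end Main

end ModApprox

theorem corollary3p4 {R : Type u} [Ring R] (hR : ModApprox.IsLeftPureSemisimple R)
    (𝒞 : ObjectProperty (ModuleCat.{u} R)) (𝒟 : ObjectProperty (ModuleCat.{u} Rᵐᵒᵖ))
    (h𝒞𝒟 : ∀ X : ModuleCat.{u} R, 𝒞 X → 𝒟 (ModApprox.plus X))
    {A C : ModuleCat.{u} R} (hC : 𝒞 C) (f : A ⟶ C) :
    (ModApprox.IsPrecover 𝒟 (ModApprox.plusMap f) → ModApprox.IsPreenvelope 𝒞 f) ∧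
      (ModApprox.IsCover 𝒟 (ModApprox.plusMap f) → ModApprox.IsEnvelope 𝒞 f) := by
  exact ⟨fun h => h.isPreenvelope hR h𝒞𝒟 hC,
    fun h => ⟨h.isPrecover.isPreenvelope hR h𝒞𝒟 hC, h.isRightMinimal.isLeftMinimal⟩⟩
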